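/- Let $G=(S,[n]\times[m],R,P,H,\mu)$ be a finite-horizon general-sum Markov game with finite state space $S$, $n,m,H\ge 1$, reward matrices $R_{hu}(s)\in\mathbb R^{n\times m}$ for $u\in\{v,e\}$ ($v$: victim, choosing rows; $e$: exploiter, choosing columns), transition probabilities $P_h(s'\mid s,a,b)$ and initial distribution $\mu$. Let $\Pi$ and $N$ be the sets of Markovian policies $\pi=\{\pi_h(s)\in\Delta(n)\}_{h,s}$ and $\nu=\{\nu_h(s)\in\Delta(m)\}_{h,s}$, where $\Delta(k)$ is the probability simplex in $\mathbb R^k$. Let $V_{hu}^{\pi,\nu}(s)$ be the expected sum of player $u$'s rewards over steps $h,\dots,H$ starting from state $s$ at step $h$, and $V_u^{\pi,\nu}$ the expected sum over all steps with initial state drawn from $\mu$. Define, for $h\in[H]$ and $s\in S$, $$\Pi^*_{hs}=\operatorname*{argmax}_{\pi\in\Pi}\min_{\nu\in N}V^{\pi,\nu}_{hv}(s),\qquad N^*_{hs}=\operatorname*{argmax}_{\nu\in N}\ \min_{\pi\in\Pi^*_{hs}\cap\bigcap_{k>h,s'}\Pi^*_{ks'}}V^{\pi,\nu}_{he}(s)$$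 (the VISER policies of the two players in the stage game $(h,s)$), and let $V^*_{hv}(s)$, $V^*_{he}(s)$ be the corresponding max-min values. A policy of the victim (exploiter) is an MPVISER policy if it lies in $\bigcap_{h,s}\Pi^*_{hs}$ (in $\bigcap_{h,s}N^*_{hs}$). Put $$Q^*_{hu}(s)[a,b]=R_{hu}(s,a,b)+\sum_{s'}P_h(s'\mid s,a,b)V^*_{(h+1)u}(s'),\quad V^*_{(H+1)u}:=0,\qquad p_e=\max_{\nu\in N}\ \min_{\pi\in\bigcap_{h,s}\Pi^*_{hs}}V_e^{\pi,\nu},$$ $$\hat N_{hs}=\bigcup_{w\in\mathbb R^m_{\ge0}}\Big\{y\in\Delta(m)\ :\ e_i^\top Q^*_{he}(s)y+(V^*_{hv}(s)1^\top-e_i^\top Q^*_{hv}(s))w\ge V^*_{he}(s)\ \ \forall i\in[n]\Big\}.$$ For matrices $A,B\in\mathbb R^{n\times m}$ and $z\in\mathbb R$ consider the linear programs $$\text{(V)}\ \max_{x\in\Delta(n),\,z'\in\mathbb R}\{z' : z'\le x^\top Ae_j\ \forall j\},\qquad \text{(E)}\ \max_{y\in\Delta(m),\,w\in\mathbb R^m_{\ge0},\,\alpha\in\mathbb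 R}\{z1^\top w-\alpha : \alpha+e_i^\top By-e_i^\top Aw\ge0\ \forall i\}.$$ The exploiter's algorithm runs over $h=H,\dots,1$ and $s\in S$: it forms the matrices $Q_{hu}(s)$ by the formula for $Q^*$ with the values already computed for step $h+1$ (zero for $h=H$), solves (V) with $A=Q_{hv}(s)$, takes its optimal value as the victim's value $z$ at $(h,s)$, solves (E) with $A=Q_{hv}(s)$, $B=Q_{he}(s)$ and this $z$, takes the optimal value as the exploiter's value at $(h,s)$, and puts $\nu^*_h(s)=y$. Any optimal solutions of the linear programs may be used. It returns $\nu^*=\{\nu^*_h(s)\}_{h,s}$. Then: 1. All the maxima and minima in the definitions of $\Pi^*_{hs}$, $N^*_{hs}$ and $p_e$ are attained; the linear programs have optimal solutions, so that the algorithm has an output. The values computed in any run are $V^*_{hv}(s)$ and $V^*_{he}(s)$. 2. Every output $\nu^*$ is an MPVISER policy for the exploiter, and its guaranteed payoff is $\min_{\pi\in\bigcap_{h,s}\Pi^*_{hs}}V_e^{\pi,\nu^*}=p_e=\sum_s\mu(s)V^*_{1e}(s)$. 3. For all $h,s$, $\hat N_{hs}$ is a non-empty polytope and is the set of VISER strategies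 of the exploiter in the stage game $(h,s)$: it equals $\{\nu_h(s):\nu\in N^*_{hs}\}$, and it also equals $\operatorname{argmax}_{y\in\Delta(m)}\min_{x\in X^*}x^\top Q^*_{he}(s)y$ with $X^*=\operatorname{argmax}_{x\in\Delta(n)}\min_{y\in\Delta(m)}x^\top Q^*_{hv}(s)y$; the max-min value of this last problem is $V^*_{he}(s)$. 4. The set of MPVISER policies of the exploiter is the non-empty polytope $\bigcap_{h,s}N^*_{hs}=\bigtimes_{h,s}\hat N_{hs}$. -/

import Mathlib

open scoped Matrix

noncomputable section

/-! ## Max-min problems -/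

/-- The worst case `min_{x ∈ X} f y x` of the decision `y`. -/
def worstCase {α β : Type*} (X : Set β) (f : α → β → ℝ) (y : α) : ℝ :=
  sInf ((fun x => f y x) '' X)

/-- The value `max_{y ∈ Y} min_{x ∈ X} f y x`. -/
def maximinValue {α β : Type*} (Y : Set α) (X : Set β) (f : α → β → ℝ) : ℝ :=
  sSup (worstCase X f '' Y)

/-- The set `argmax_{y ∈ Y} min_{x ∈ X} f y x`. -/
def maximinSet {α β : Type*} (Y : Set α) (X : Set β) (f : α → β → ℝ) : Set α :=
  {y | y ∈ Y ∧ ∀ y' ∈ Y, worstCase X f y' ≤ worstCase X f y}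

/-- `max_{y ∈ Y} min_{x ∈ X} f y x` is a genuine maximum of genuine minima, so that
`worstCase` and `maximinValue` are not default values of `sInf` and `sSup`. -/
def MaximinAttained {α β : Type*} (Y : Set α) (X : Set β) (f : α → β → ℝ) : Prop :=
  (∀ y ∈ Y, IsLeast ((fun x => f y x) '' X) (worstCase X f y)) ∧
    IsGreatest (worstCase X f '' Y) (maximinValue Y X f)

/-- A polytope: a bounded solution set of finitely many linear inequalities. -/
def IsPolytope {E : Type*} [NormedAddCommGroup E] [NormedSpace ℝ E] (K : Set E) : Prop :=
  Bornology.IsBounded K ∧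
    ∃ (k : ℕ) (f : Fin k → E →ₗ[ℝ] ℝ) (b : Fin k → ℝ), K = {x | ∀ i, f i x ≤ b i}

/-! ## Bimatrix games `(A, B)`: the row player is the victim, the column player the exploiter -/

/-- `X* = argmax_{x ∈ Δ(n)} min_{y ∈ Δ(m)} xᵀ A y`. -/
def securitySet {n m : ℕ} (A : Matrix (Fin n) (Fin m) ℝ) : Set (Fin n → ℝ) :=
  maximinSet (stdSimplex ℝ (Fin n)) (stdSimplex ℝ (Fin m)) (fun x y => x ⬝ᵥ (A *ᵥ y))

/-- `BR(X*) = argmax_{y ∈ Δ(m)} min_{x ∈ X*} xᵀ B y`, the exploiter's VISER strategies. -/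
def exploiterViser {n m : ℕ} (A B : Matrix (Fin n) (Fin m) ℝ) : Set (Fin m → ℝ) :=
  maximinSet (stdSimplex ℝ (Fin m)) (securitySet A) (fun y x => x ⬝ᵥ (B *ᵥ y))

/-- `p_e = max_{y ∈ Δ(m)} min_{x ∈ X*} xᵀ B y`. -/
def exploiterPayoff {n m : ℕ} (A B : Matrix (Fin n) (Fin m) ℝ) : ℝ :=
  maximinValue (stdSimplex ℝ (Fin m)) (securitySet A) (fun y x => x ⬝ᵥ (B *ᵥ y))

/-- Feasibility of `(x, z)` in the victim's LP. -/
def VictimFeasible {n m : ℕ} (A : Matrix (Fin n) (Fin m) ℝ) (x : Fin n → ℝ) (z : ℝ) : Prop :=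
  (∀ j, z ≤ ∑ i, x i * A i j) ∧ ∑ i, x i = 1 ∧ ∀ i, 0 ≤ x i

/-- `(x, z)` is an optimal solution of the victim's LP: maximise `z`. -/
def VictimOptimal {n m : ℕ} (A : Matrix (Fin n) (Fin m) ℝ) (x : Fin n → ℝ) (z : ℝ) : Prop :=
  VictimFeasible A x z ∧ ∀ x' z', VictimFeasible A x' z' → z' ≤ z

/-- Feasibility of `(y, w, α)` in the exploiter's LP. -/
def ExploiterFeasible {n m : ℕ} (A B : Matrix (Fin n) (Fin m) ℝ)
    (y w : Fin m → ℝ) (α : ℝ) : Prop :=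
  (∀ i, 0 ≤ α + (B *ᵥ y) i - (A *ᵥ w) i) ∧ ∑ j, y j = 1 ∧ (∀ j, 0 ≤ y j) ∧ ∀ j, 0 ≤ w j

/-- `(y, w, α)` is an optimal solution of the exploiter's LP: maximise `z 1ᵀw - α`,
where `z` is the optimal value of the victim's LP. -/
def ExploiterOptimal {n m : ℕ} (A B : Matrix (Fin n) (Fin m) ℝ) (z : ℝ)
    (y w : Fin m → ℝ) (α : ℝ) : Prop :=
  ExploiterFeasible A B y w α ∧
    ∀ y' w' α', ExploiterFeasible A B y' w' α' → z * ∑ j, w' j - α' ≤ z * ∑ j, w j - α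

/-! ## Finite-horizon Markov games -/

inductive Player
  | victim
  | exploiter

/-- A two-player Markov game with finite state space `S`, action sets `Fin n` (victim) and `Fin m`
(exploiter) and horizon `H`. The steps `1, …, H` are numbered `0, …, H - 1`. -/
structure MarkovGame (S : Type*) [Fintype S] (n m H : ℕ) where
  /-- the reward matrix of each player at each step and state -/
  R : Player → Fin H → S → Matrix (Fin n) (Fin m) ℝ
  /-- `P h s a b s'` is the probability of moving from `s` to `s'` at step `h` under `(a, b)` -/
  P : Fin H → S → Fin n → Fin m → S → ℝ
  P_mem : ∀ h s a b, P h s a b ∈ stdSimplex ℝ S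
  /-- the initial state distribution -/
  μ : S → ℝ
  μ_mem : μ ∈ stdSimplex ℝ S

/-- The Markovian policies of a player with `k` actions (`Π` for `k = n`, `N` for `k = m`). -/
def policies (S : Type*) (H k : ℕ) : Set (Fin H → S → Fin k → ℝ) :=
  {π | ∀ h s, π h s ∈ stdSimplex ℝ (Fin k)}

/-- The distribution of a state that equals `s` with certainty. -/
def pointMass {S : Type*} (s : S) : S → ℝ := Set.indicator {s} (fun _ => 1)

/-- The value at step `h + 1` of a function of step and state, with value `0` after the last step. -/
def nextValue {S : Type*} {H : ℕ} (W : Fin H → S → ℝ) (h : Fin H) (s : S) : ℝ :=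
  if hk : (h : ℕ) + 1 < H then W ⟨h + 1, hk⟩ s else 0

namespace MarkovGame

variable {S : Type*} [Fintype S] {n m H : ℕ} (G : MarkovGame S n m H)

/-- The probability that the state moves from `x` to `x'` at step `k` when `(π, ν)` is played. -/
def transition (π : Fin H → S → Fin n → ℝ) (ν : Fin H → S → Fin m → ℝ) (k : Fin H) (x x' : S) : ℝ :=
  ∑ a, ∑ b, π k x a * ν k x b * G.P k x a b x'

/-- The distribution of the state at step `h + j` when `(π, ν)` is played and the state at step `h`
has distribution `d`. -/
def stateLaw (π : Fin H → S → Fin n → ℝ) (ν : Fin H → S → Fin m → ℝ) (h : Fin H) (d : S → ℝ) :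
    ℕ → S → ℝ
  | 0 => d
  | j + 1 => fun x' =>
      if hk : (h : ℕ) + j < H then
        ∑ x, stateLaw π ν h d j x * G.transition π ν ⟨h + j, hk⟩ x x'
      else 0

/-- The expected cumulative reward `E[∑_{k ≥ h} π_k(s_k)ᵀ R_{ku}(s_k) ν_k(s_k)]` of player `u`
over the steps `k ≥ h`, when `s_h` has distribution `d` and `(π, ν)` is played. -/
def expectedReward (u : Player) (h : Fin H) (d : S → ℝ)
    (π : Fin H → S → Fin n → ℝ) (ν : Fin H → S → Fin m → ℝ) : ℝ :=
  ∑ k ∈ Finset.Ici h, ∑ x,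
    G.stateLaw π ν h d ((k : ℕ) - (h : ℕ)) x * (π k x ⬝ᵥ (G.R u k x *ᵥ ν k x))

/-- The stage value `V_{hu}^{π,ν}(s)`. -/
def value (u : Player) (h : Fin H) (s : S)
    (π : Fin H → S → Fin n → ℝ) (ν : Fin H → S → Fin m → ℝ) : ℝ :=
  G.expectedReward u h (pointMass s) π ν

/-- The stage VISER set `Π*_{hs}` of the victim. -/
def victimStage (h : Fin H) (s : S) : Set (Fin H → S → Fin n → ℝ) :=
  maximinSet (policies S H n) (policies S H m) (fun π ν => G.value .victim h s π ν)

/-- `Π*_{hs} ∩ ⋂_{k > h, s'} Π*_{ks'}`: the victim is optimal now and at every future stage. -/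
def victimFuture (h : Fin H) (s : S) : Set (Fin H → S → Fin n → ℝ) :=
  {π | π ∈ G.victimStage h s ∧ ∀ k, h < k → ∀ s', π ∈ G.victimStage k s'}

/-- The stage VISER set `N*_{hs}` of the exploiter. -/
def exploiterStage (h : Fin H) (s : S) : Set (Fin H → S → Fin m → ℝ) :=
  maximinSet (policies S H m) (G.victimFuture h s) (fun ν π => G.value .exploiter h s π ν)

/-- The MPVISER policies of the victim, `⋂_{h,s} Π*_{hs}`. -/
def victimMPViser : Set (Fin H → S → Fin n → ℝ) := ⋂ h, ⋂ s, G.victimStage h s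

/-- The MPVISER policies of the exploiter, `⋂_{h,s} N*_{hs}`. -/
def exploiterMPViser : Set (Fin H → S → Fin m → ℝ) := ⋂ h, ⋂ s, G.exploiterStage h s

/-- The optimal stage values `V*_{hv}(s)` and `V*_{he}(s)`. -/
def optValue : Player → Fin H → S → ℝ
  | .victim, h, s =>
      maximinValue (policies S H n) (policies S H m) (fun π ν => G.value .victim h s π ν)
  | .exploiter, h, s =>
      maximinValue (policies S H m) (G.victimFuture h s) (fun ν π => G.value .exploiter h s π ν)

/-- The matrix `R_{hu}(s,a,b) + ∑_{s'} P_h(s' ∣ s,a,b) W_{h+1}(s')` for continuation values `W`. -/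
def stageMatrix (u : Player) (W : Fin H → S → ℝ) (h : Fin H) (s : S) :
    Matrix (Fin n) (Fin m) ℝ :=
  Matrix.of fun a b => G.R u h s a b + ∑ s', G.P h s a b s' * nextValue W h s'

/-- The bimatrix stage games `Q*_{hu}(s)`. -/
def optQ (u : Player) (h : Fin H) (s : S) : Matrix (Fin n) (Fin m) ℝ :=
  G.stageMatrix u (G.optValue u) h s

/-- The set `N̂_{hs}`, the projection to the `y`-coordinate of a polyhedron in `(y, w)`. -/
def exploiterHat (h : Fin H) (s : S) : Set (Fin m → ℝ) :=
  ⋃ w ∈ {w : Fin m → ℝ | ∀ j, 0 ≤ w j},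
    {y | y ∈ stdSimplex ℝ (Fin m) ∧ ∀ i,
      G.optValue .exploiter h s ≤ (G.optQ .exploiter h s *ᵥ y) i
        + ∑ j, (G.optValue .victim h s - G.optQ .victim h s i j) * w j}

/-- The expected total payoff `V_e^{π,ν}` of the exploiter, the initial state being drawn from `μ`;
the first argument is a proof that there is a first step. -/
def exploiterTotal (hH : 0 < H) (ν : Fin H → S → Fin m → ℝ) (π : Fin H → S → Fin n → ℝ) : ℝ :=
  G.expectedReward .exploiter ⟨0, hH⟩ G.μ π ν

/-- The exploiter's guaranteed payoff `p_e` for the game: the max-min of its expected total payoff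
when the victim plays an unknown MPVISER policy. -/
def guaranteedPayoff (hH : 0 < H) : ℝ :=
  maximinValue (policies S H m) G.victimMPViser (G.exploiterTotal hH)

end MarkovGame

/-- Everything computed in one run of the exploiter's backward induction. -/
structure ExploiterTrace (S : Type*) (n m H : ℕ) where
  /-- the stage matrices of both players -/
  Q : Player → Fin H → S → Matrix (Fin n) (Fin m) ℝ
  /-- the stage values of both players -/
  V : Player → Fin H → S → ℝ
  /-- the victim's strategies found by the victim's LP -/
  π : Fin H → S → Fin n → ℝ
  /-- the output policy -/
  ν : Fin H → S → Fin m → ℝ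
  w : Fin H → S → Fin m → ℝ
  α : Fin H → S → ℝ

/-- `T` is a run of the exploiter's backward induction on `G`: at every step and state the stage
matrices are built from the values computed for the next step, then the victim's LP and, with its
optimal value, the exploiter's LP are solved; any optimal LP solutions may be returned. -/
structure MarkovGame.IsExploiterRun {S : Type*} [Fintype S] {n m H : ℕ} (G : MarkovGame S n m H)
    (T : ExploiterTrace S n m H) : Prop where
  matrices : ∀ u h s, T.Q u h s = G.stageMatrix u (T.V u) h s
  victim_lp : ∀ h s, VictimOptimal (T.Q .victim h s) (T.π h s) (T.V .victim h s)
  exploiter_lp : ∀ h s, ExploiterOptimal (T.Q .victim h s) (T.Q .exploiter h s) (T.V .victim h s)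
    (T.ν h s) (T.w h s) (T.α h s)
  exploiter_value : ∀ h s, T.V .exploiter h s = T.V .victim h s * ∑ j, T.w h s j - T.α h s

end

/-! In one bimatrix game with victim security value `z`, the set `X*` is cut out of the simplex by
the inequalities `xᵀA ≥ z`. By Farkas, a bound `v ≤ xᵀc` holds on all of `X*` exactly when some `w ≥
0` satisfies `v ≤ c i + ∑ j, (z - A i j) * w j` for every `i` (`forall_securitySet_le_iff`). With `c
= By` this turns the exploiter's max-min problem into its linear program, where `α = z 1ᵀw - v`. It
also shows the VISER set to be the projection of a polyhedron in `(y, w)`. Fourier-Motzkin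
elimination gives both the Farkas lemma and the closure of polyhedra under projection. The Markov
game reduces to such stage games by the Bellman equation and the monotonicity of one-step payoffs in
the continuation value. `BackwardGame` isolates the argument: stagewise max-min decisions guarantee
the recursive value `W`, and one stagewise response of the follower keeps the leader at or below `W`
at all stages at once. It is used twice. First the victim leads against all policies, which
identifies `victimFuture` and `victimMPViser` by stagewise security sets. Then the exploiter leads
against a victim restricted to these sets. An algorithm run solves the same two recursions. -/

noncomputable section

/-! ## Polyhedra and the Fourier-Motzkin elimination -/

/-- A polyhedron: the solution set of finitely many linear inequalities. -/
def IsPolyhedron {E : Type*} [AddCommGroup E] [Module ℝ E] (K : Set E) : Prop :=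
  ∃ (ι : Type) (_ : Fintype ι) (f : ι → E →ₗ[ℝ] ℝ) (b : ι → ℝ), K = {x | ∀ i, f i x ≤ b i}

namespace IsPolyhedron

variable {E F : Type*} [AddCommGroup E] [Module ℝ E] [AddCommGroup F] [Module ℝ F]

theorem halfspace (f : E →ₗ[ℝ] ℝ) (b : ℝ) : IsPolyhedron {x | f x ≤ b} :=
  ⟨Unit, inferInstance, fun _ => f, fun _ => b, by simp⟩

theorem univ : IsPolyhedron (Set.univ : Set E) :=
  ⟨Empty, inferInstance, fun _ => 0, fun _ => 0, by simp⟩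

theorem preimage {K : Set F} (hK : IsPolyhedron K) (g : E →ₗ[ℝ] F) :
    IsPolyhedron (g ⁻¹' K) := by
  obtain ⟨ι, _, f, b, rfl⟩ := hK
  exact ⟨ι, inferInstance, fun i => f i ∘ₗ g, b, by ext; simp⟩

theorem iInter {κ : Type*} [Finite κ] {K : κ → Set E} (hK : ∀ k, IsPolyhedron (K k)) :
    IsPolyhedron (⋂ k, K k) := by
  obtain ⟨N, ⟨e⟩⟩ := Finite.exists_equiv_fin κ
  choose ι hι f b h using hK
  refine ⟨Σ i : Fin N, ι (e.symm i), inferInstance, fun p => f _ p.2, fun p => b _ p.2, ?_⟩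
  ext x
  simp only [Set.mem_iInter, Set.mem_ofPred_eq, Sigma.forall]
  constructor
  · intro hx i j
    have := hx (e.symm i)
    rw [h] at this
    exact this j
  · intro hx k
    obtain ⟨i, rfl⟩ := e.symm.surjective k
    rw [h]
    exact hx i

theorem inter {K L : Set E} (hK : IsPolyhedron K) (hL : IsPolyhedron L) :
    IsPolyhedron (K ∩ L) := by
  rw [Set.inter_eq_iInter]
  exact iInter fun b => by cases b <;> assumption

theorem setOf_forall {κ : Type*} [Finite κ] {p : κ → E → Prop}
    (h : ∀ k, IsPolyhedron {x | p k x}) : IsPolyhedron {x | ∀ k, p k x} := by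
  rw [Set.ofPred_forall]
  exact iInter h

theorem setOf_imp {q : Prop} {p : E → Prop} (h : q → IsPolyhedron {x | p x}) :
    IsPolyhedron {x | q → p x} := by
  by_cases hq : q
  · simpa [hq] using h hq
  · simpa [hq] using univ

/-- The feasibility test for one eliminated variable. An empty `L` is treated apart, since `sSup ∅ =
0` need not lie below `U`. -/
theorem exists_between_of_finite {L U : Set ℝ} (hL : L.Finite) (hU : U.Finite)
    (h : ∀ l ∈ L, ∀ u ∈ U, l ≤ u) : ∃ t, (∀ l ∈ L, l ≤ t) ∧ ∀ u ∈ U, t ≤ u := by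
  rcases L.eq_empty_or_nonempty with rfl | hne
  · obtain ⟨t, ht⟩ := hU.bddBelow
    exact ⟨t, by simp, fun u hu => ht hu⟩
  · exact ⟨sSup L, fun l hl => le_csSup hL.bddAbove hl, fun u hu => csSup_le hne fun l hl => h l hl u hu⟩

/-- The elimination of one real variable. -/
theorem exists_real {K : Set (E × ℝ)} (hK : IsPolyhedron K) :
    IsPolyhedron {x : E | ∃ t, (x, t) ∈ K} := by
  obtain ⟨ι, _, f, b, rfl⟩ := hK
  set g : ι → E →ₗ[ℝ] ℝ := fun i => f i ∘ₗ LinearMap.inl ℝ E ℝ with hg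
  set c : ι → ℝ := fun i => f i (0, 1) with hc
  have hf : ∀ i x t, f i (x, t) = g i x + c i * t := by
    intro i x t
    have : (x, t) = (x, (0 : ℝ)) + t • ((0 : E), (1 : ℝ)) := by simp
    rw [this, map_add, map_smul]
    simp [hg, hc, mul_comm]
  -- Rows not involving `t` are kept. Each pair of rows with coefficients of `t` of opposite sign is
  -- combined so that `t` cancels.
  have key : {x : E | ∃ t, (x, t) ∈ {p | ∀ i, f i p ≤ b i}} =
      {x | ∀ i, c i = 0 → g i x ≤ b i} ∩
        {x | ∀ i, 0 < c i → ∀ j, c j < 0 → (c i • g j - c j • g i) x ≤ c i * b j - c j * b i} := by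
    ext x
    simp only [Set.mem_ofPred_eq, hf, Set.mem_inter_iff, LinearMap.sub_apply, LinearMap.smul_apply,
      smul_eq_mul]
    constructor
    · rintro ⟨t, ht⟩
      refine ⟨fun i hi => by simpa [hi] using ht i, fun i hi j hj => ?_⟩
      nlinarith [mul_le_mul_of_nonneg_left (ht j) hi.le,
        mul_le_mul_of_nonneg_left (ht i) (neg_nonneg.2 hj.le)]
    · rintro ⟨h0, h1⟩
      obtain ⟨t, htl, htu⟩ := exists_between_of_finite
        (L := (fun j => (b j - g j x) / c j) '' {j | c j < 0})
        (U := (fun i => (b i - g i x) / c i) '' {i | 0 < c i})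
        (Set.toFinite _) (Set.toFinite _) (by
          rintro _ ⟨j, hj, rfl⟩ _ ⟨i, hi, rfl⟩
          simp only [Set.mem_ofPred_eq] at hi hj
          rw [le_div_iff₀ hi, div_mul_eq_mul_div, div_le_iff_of_neg hj]
          nlinarith [h1 i hi j hj])
      refine ⟨t, fun i => ?_⟩
      rcases lt_trichotomy (c i) 0 with hi | hi | hi
      · have := htl _ ⟨i, hi, rfl⟩
        rw [div_le_iff_of_neg hi] at this
        linarith
      · simpa [hi] using h0 i hi
      · have := htu _ ⟨i, hi, rfl⟩
        rw [le_div_iff₀ hi] at this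
        linarith
  rw [key]
  exact (setOf_forall fun i => setOf_imp fun _ => halfspace _ _).inter
    (setOf_forall fun i => setOf_imp fun _ => setOf_forall fun j => setOf_imp fun _ => halfspace _ _)

/-- The projection of a polyhedron is a polyhedron. -/
theorem exists_pi {m : ℕ} {K : Set (E × (Fin m → ℝ))} (hK : IsPolyhedron K) :
    IsPolyhedron {x : E | ∃ w, (x, w) ∈ K} := by
  induction m generalizing E with
  | zero =>
    convert hK.preimage (LinearMap.inl ℝ E (Fin 0 → ℝ)) using 1
    ext x
    simp only [Set.mem_ofPred_eq, Set.mem_preimage, LinearMap.inl_apply]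
    exact ⟨fun ⟨w, hw⟩ => by rwa [Subsingleton.elim 0 w], fun h => ⟨0, h⟩⟩
  | succ m ih =>
    -- `g` separates the head coordinate of `w` as a real factor, which one elimination then
    -- removes.
    let g : (E × (Fin m → ℝ)) × ℝ →ₗ[ℝ] E × (Fin (m + 1) → ℝ) :=
      { toFun := fun p => (p.1.1, Fin.cons p.2 p.1.2)
        map_add' := fun p q => by
          ext i
          · rfl
          · refine Fin.cases ?_ (fun j => ?_) i <;> simp
        map_smul' := fun r p => by
          ext i
          · rfl
          · refine Fin.cases ?_ (fun j => ?_) i <;> simp }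
    convert ih (hK.preimage g).exists_real using 1
    ext x
    simp only [Set.mem_ofPred_eq, Set.mem_preimage]
    constructor
    · rintro ⟨w, hw⟩
      exact ⟨Fin.tail w, w 0, by simpa [g] using hw⟩
    · rintro ⟨w, t, h⟩
      exact ⟨_, h⟩

theorem isPolytope {E : Type*} [NormedAddCommGroup E] [NormedSpace ℝ E] {K : Set E}
    (hK : IsPolyhedron K) (hb : Bornology.IsBounded K) : IsPolytope K := by
  obtain ⟨ι, _, f, b, rfl⟩ := hK
  refine ⟨hb, Fintype.card ι, fun i => f ((Fintype.equivFin ι).symm i),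
    fun i => b ((Fintype.equivFin ι).symm i), ?_⟩
  ext x
  exact ⟨fun h i => h _, fun h i => by simpa using h (Fintype.equivFin ι i)⟩

end IsPolyhedron

theorem IsPolytope.isPolyhedron {E : Type*} [NormedAddCommGroup E] [NormedSpace ℝ E] {K : Set E}
    (hK : IsPolytope K) : IsPolyhedron K := by
  obtain ⟨-, k, f, b, h⟩ := hK
  exact ⟨Fin k, inferInstance, f, b, h⟩

theorem isPolyhedron_stdSimplex (m : ℕ) : IsPolyhedron (stdSimplex ℝ (Fin m)) := by
  have h0 : IsPolyhedron {y : Fin m → ℝ | ∀ j, 0 ≤ y j} :=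
    .setOf_forall fun j => by
      simpa using IsPolyhedron.halfspace (-LinearMap.proj (R := ℝ) (φ := fun _ : Fin m => ℝ) j) 0
  have h1 : IsPolyhedron {y : Fin m → ℝ | ∑ j, y j ≤ 1} := by
    simpa using IsPolyhedron.halfspace (∑ j, LinearMap.proj (R := ℝ) (φ := fun _ : Fin m => ℝ) j) 1
  have h2 : IsPolyhedron {y : Fin m → ℝ | -∑ j, y j ≤ -1} := by
    simpa using
      IsPolyhedron.halfspace (-∑ j, LinearMap.proj (R := ℝ) (φ := fun _ : Fin m => ℝ) j) (-1)
  convert h0.inter (h1.inter h2) using 1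
  ext y
  simp only [stdSimplex, Set.mem_ofPred_eq, Set.mem_inter_iff, neg_le_neg_iff]
  exact and_congr_right fun _ => le_antisymm_iff

/-! ## Linear inequalities for a matrix -/

section Matrix

variable {n m : ℕ}

/-- The set of all `(c, w)` with `w ≥ 0` and `A w ≤ c`. -/
theorem isPolyhedron_mulVec_le (A : Matrix (Fin n) (Fin m) ℝ) :
    IsPolyhedron {p : (Fin n → ℝ) × (Fin m → ℝ) | (∀ j, 0 ≤ p.2 j) ∧ ∀ i, (A *ᵥ p.2) i ≤ p.1 i} := by
  refine .inter (.setOf_forall fun j => ?_) (.setOf_forall fun i => ?_)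
  · simpa using IsPolyhedron.halfspace
      (-(LinearMap.proj (R := ℝ) (φ := fun _ : Fin m => ℝ) j ∘ₗ LinearMap.snd ℝ (Fin n → ℝ) _)) 0
  · convert IsPolyhedron.halfspace
      (LinearMap.proj (R := ℝ) (φ := fun _ : Fin n => ℝ) i ∘ₗ
        (A.mulVecLin ∘ₗ LinearMap.snd ℝ (Fin n → ℝ) _ - LinearMap.fst ℝ _ (Fin m → ℝ))) 0 using 1
    ext p
    simp

/-- The Farkas lemma. -/
theorem exists_nonneg_mulVec_le (A : Matrix (Fin n) (Fin m) ℝ) (c : Fin n → ℝ)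
    (h : ∀ x : Fin n → ℝ, (∀ i, 0 ≤ x i) → (∀ j, 0 ≤ (x ᵥ* A) j) → 0 ≤ x ⬝ᵥ c) :
    ∃ w : Fin m → ℝ, (∀ j, 0 ≤ w j) ∧ ∀ i, (A *ᵥ w) i ≤ c i := by
  set K := {c : Fin n → ℝ | ∃ w : Fin m → ℝ, (∀ j, 0 ≤ w j) ∧ ∀ i, (A *ᵥ w) i ≤ c i}
  change c ∈ K
  -- The cone `K` is a projection, hence given by finitely many inequalities; a violated one plays
  -- the role of a separating hyperplane.
  have hK : IsPolyhedron K := (isPolyhedron_mulVec_le A).exists_pi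
  obtain ⟨ι, _, f, b, hKf⟩ := hK
  have h0 : (0 : Fin n → ℝ) ∈ K := ⟨0, by simp, by simp⟩
  have hsmul : ∀ c ∈ K, ∀ r : ℝ, 0 ≤ r → r • c ∈ K := by
    rintro c ⟨w, hw, hA⟩ r hr
    refine ⟨r • w, fun j => mul_nonneg hr (hw j), fun i => ?_⟩
    rw [Matrix.mulVec_smul]
    exact mul_le_mul_of_nonneg_left (hA i) hr
  by_contra hc
  rw [hKf, Set.mem_ofPred_eq] at hc
  push Not at hc
  obtain ⟨k, hk⟩ := hc
  have hle : ∀ c ∈ K, f k c ≤ b k := fun c hc => by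
    rw [hKf] at hc
    exact hc k
  have hb : 0 ≤ b k := by simpa using hle 0 h0
  -- A functional bounded above on a cone is nonpositive there: scaling by `(b k + 1) / f k c` would
  -- exceed the bound.
  have hnonpos : ∀ c ∈ K, f k c ≤ 0 := by
    intro c hc
    by_contra! hpos
    have := hle _ (hsmul c hc ((b k + 1) / f k c) (by positivity))
    rw [map_smul, smul_eq_mul, div_mul_cancel₀ _ hpos.ne'] at this
    linarith
  have hfk : ∀ c, f k c = ∑ i, f k (Pi.single i 1) * c i := fun c => by
    rw [LinearMap.pi_apply_eq_sum_univ (f k) c]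
    refine Finset.sum_congr rfl fun i _ => ?_
    rw [smul_eq_mul, mul_comm]
    congr 2
    ext j
    simp [Pi.single_apply, eq_comm]
  -- The coefficients of `-f k` are admissible multipliers: `K` contains the unit vectors (take `w =
  -- 0`) and the columns of `A` (take `w` a unit vector).
  have := h (fun i => -f k (Pi.single i 1)) (fun i => ?_) (fun j => ?_)
  · rw [dotProduct] at this
    simp only [neg_mul, Finset.sum_neg_distrib, ← hfk] at this
    linarith
  · refine neg_nonneg.2 (hnonpos _ ⟨0, by simp, fun l => ?_⟩)
    simp only [Matrix.mulVec_zero, Pi.zero_apply]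
    by_cases hl : l = i
    · subst hl; simp
    · simp [hl]
  · have hA : f k (fun i => A i j) ≤ 0 := hnonpos _ ⟨Pi.single j 1, fun l => ?_, fun i => by simp⟩
    · rw [hfk] at hA
      simp only [Matrix.vecMul, dotProduct, neg_mul, Finset.sum_neg_distrib]
      linarith
    · by_cases hl : l = j
      · subst hl; simp
      · simp [hl]

end Matrix

/-! ## Max-min problems -/

section Maximin

variable {α β : Type*} {Y : Set α} {X : Set β} {f : α → β → ℝ}

/-- The infimum of a jointly continuous function over a compact set is continuous in the remaining
variable, so it attains its maximum on `Y`. -/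
theorem maximinAttained_of_isCompact [TopologicalSpace α] [TopologicalSpace β] (hY : IsCompact Y)
    (hX : IsCompact X) (hYne : Y.Nonempty) (hXne : X.Nonempty)
    (hf : Continuous fun p : α × β => f p.1 p.2) : MaximinAttained Y X f := by
  have hf' : ∀ y, Continuous (f y) := fun y => hf.comp (by fun_prop : Continuous fun x => (y, x))
  refine ⟨fun y _ => (hX.image (hf' y)).isLeast_sInf (hXne.image _), ?_⟩
  have hc : Continuous (worstCase X f) := hX.continuous_sInf hf
  exact (hY.image hc).isGreatest_sSup (hYne.image _)

namespace MaximinAttained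

theorem worstCase_le (h : MaximinAttained Y X f) {y : α} (hy : y ∈ Y) {x : β} (hx : x ∈ X) :
    worstCase X f y ≤ f y x := (h.1 y hy).2 ⟨x, hx, rfl⟩

theorem exists_eq_worstCase (h : MaximinAttained Y X f) {y : α} (hy : y ∈ Y) :
    ∃ x ∈ X, f y x = worstCase X f y := (h.1 y hy).1

theorem worstCase_le_maximinValue (h : MaximinAttained Y X f) {y : α} (hy : y ∈ Y) :
    worstCase X f y ≤ maximinValue Y X f := h.2.2 ⟨y, hy, rfl⟩

theorem le_worstCase_iff (h : MaximinAttained Y X f) {y : α} (hy : y ∈ Y) {v : ℝ} :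
    v ≤ worstCase X f y ↔ ∀ x ∈ X, v ≤ f y x := by
  refine ⟨fun hv x hx => hv.trans (h.worstCase_le hy hx), fun hv => ?_⟩
  obtain ⟨x, hx, he⟩ := h.exists_eq_worstCase hy
  exact (hv x hx).trans_eq he

theorem mem_maximinSet_iff_worstCase (h : MaximinAttained Y X f) {y : α} :
    y ∈ maximinSet Y X f ↔ y ∈ Y ∧ maximinValue Y X f ≤ worstCase X f y := by
  refine and_congr_right fun _ => ⟨fun hy' => ?_, fun hy' y' hy'' => ?_⟩
  · obtain ⟨y', hy'', he⟩ := h.2.1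
    exact he ▸ hy' y' hy''
  · exact (h.worstCase_le_maximinValue hy'').trans hy'

theorem mem_maximinSet_iff (h : MaximinAttained Y X f) {y : α} :
    y ∈ maximinSet Y X f ↔ y ∈ Y ∧ ∀ x ∈ X, maximinValue Y X f ≤ f y x := by
  rw [h.mem_maximinSet_iff_worstCase]
  exact and_congr_right fun hy => h.le_worstCase_iff hy

theorem worstCase_eq (h : MaximinAttained Y X f) {y : α} (hy : y ∈ maximinSet Y X f) :
    worstCase X f y = maximinValue Y X f :=
  (h.worstCase_le_maximinValue hy.1).antisymm (h.mem_maximinSet_iff_worstCase.1 hy).2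

theorem nonempty (h : MaximinAttained Y X f) : (maximinSet Y X f).Nonempty := by
  obtain ⟨y, hy, he⟩ := h.2.1
  exact ⟨y, h.mem_maximinSet_iff_worstCase.2 ⟨hy, he.ge⟩⟩

theorem maximinValue_eq (h : MaximinAttained Y X f) {v : ℝ} (hle : ∀ y ∈ Y, ∃ x ∈ X, f y x ≤ v)
    (hge : ∃ y ∈ Y, ∀ x ∈ X, v ≤ f y x) : maximinValue Y X f = v := by
  refine le_antisymm ?_ ?_
  · obtain ⟨y, hy, he⟩ := h.2.1
    obtain ⟨x, hx, hxv⟩ := hle y hy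
    exact he ▸ (h.worstCase_le hy hx).trans hxv
  · obtain ⟨y, hy, hyv⟩ := hge
    exact ((h.le_worstCase_iff hy).2 hyv).trans (h.worstCase_le_maximinValue hy)

end MaximinAttained

end Maximin

/-! ## Bimatrix games -/

section Bimatrix

variable {n m : ℕ} (A B : Matrix (Fin n) (Fin m) ℝ)

/-- The security value `max_{x ∈ Δ(n)} min_{y ∈ Δ(m)} xᵀ A y` of the victim. -/
def securityValue : ℝ :=
  maximinValue (stdSimplex ℝ (Fin n)) (stdSimplex ℝ (Fin m)) (fun x y => x ⬝ᵥ (A *ᵥ y))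

theorem stdSimplex_nonempty {k : ℕ} (hk : 0 < k) : (stdSimplex ℝ (Fin k)).Nonempty :=
  ⟨_, single_mem_stdSimplex ℝ (⟨0, hk⟩ : Fin k)⟩

theorem le_dotProduct_of_mem_stdSimplex {k : ℕ} {y c : Fin k → ℝ} {v : ℝ}
    (hy : y ∈ stdSimplex ℝ (Fin k)) (h : ∀ j, v ≤ c j) : v ≤ y ⬝ᵥ c := by
  calc v = ∑ j, y j * v := by rw [← Finset.sum_mul, hy.2, one_mul]
    _ ≤ y ⬝ᵥ c := Finset.sum_le_sum fun j _ => mul_le_mul_of_nonneg_left (h j) (hy.1 j)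

theorem maximinAttained_security (hn : 0 < n) (hm : 0 < m) :
    MaximinAttained (stdSimplex ℝ (Fin n)) (stdSimplex ℝ (Fin m))
      (fun x y => x ⬝ᵥ (A *ᵥ y)) :=
  maximinAttained_of_isCompact (isCompact_stdSimplex ℝ _) (isCompact_stdSimplex ℝ _)
    (stdSimplex_nonempty hn) (stdSimplex_nonempty hm) (by fun_prop)

variable {A} in
-- The payoff is linear in `y`, so only the vertices of the simplex need testing.
theorem mem_securitySet_iff (hn : 0 < n) (hm : 0 < m) {x : Fin n → ℝ} :
    x ∈ securitySet A ↔ x ∈ stdSimplex ℝ (Fin n) ∧ ∀ j, securityValue A ≤ (x ᵥ* A) j := by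
  rw [securitySet, (maximinAttained_security A hn hm).mem_maximinSet_iff]
  refine and_congr_right fun _ => ⟨fun h j => ?_, fun h y hy => ?_⟩
  · have := h _ (single_mem_stdSimplex ℝ j)
    rwa [Matrix.dotProduct_mulVec, dotProduct_single_one] at this
  · rw [Matrix.dotProduct_mulVec, dotProduct_comm]
    exact le_dotProduct_of_mem_stdSimplex hy h

theorem securitySet_nonempty (hn : 0 < n) (hm : 0 < m) : (securitySet A).Nonempty :=
  (maximinAttained_security A hn hm).nonempty

theorem isCompact_securitySet (hn : 0 < n) (hm : 0 < m) : IsCompact (securitySet A) := by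
  have : securitySet A = stdSimplex ℝ (Fin n) ∩ ⋂ j, {x | securityValue A ≤ (x ᵥ* A) j} := by
    ext x
    simp [mem_securitySet_iff hn hm]
  rw [this]
  exact (isCompact_stdSimplex ℝ _).inter_right
    (isClosed_iInter fun j => isClosed_le continuous_const (by fun_prop))

theorem maximinAttained_exploiter (hn : 0 < n) (hm : 0 < m) :
    MaximinAttained (stdSimplex ℝ (Fin m)) (securitySet A) (fun y x => x ⬝ᵥ (B *ᵥ y)) :=
  maximinAttained_of_isCompact (isCompact_stdSimplex ℝ _) (isCompact_securitySet A hn hm)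
    (stdSimplex_nonempty hm) (securitySet_nonempty A hn hm) (by fun_prop)

theorem exploiterViser_nonempty (hn : 0 < n) (hm : 0 < m) : (exploiterViser A B).Nonempty :=
  (maximinAttained_exploiter A B hn hm).nonempty

variable {A} in
theorem VictimFeasible.le_securityValue (hn : 0 < n) (hm : 0 < m) {x : Fin n → ℝ} {z : ℝ}
    (h : VictimFeasible A x z) : z ≤ securityValue A := by
  have hA := maximinAttained_security A hn hm
  have hx : x ∈ stdSimplex ℝ (Fin n) := ⟨h.2.2, h.2.1⟩
  refine ((hA.le_worstCase_iff hx).2 fun y hy => ?_).trans (hA.worstCase_le_maximinValue hx)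
  rw [Matrix.dotProduct_mulVec, dotProduct_comm]
  exact le_dotProduct_of_mem_stdSimplex hy h.1

theorem victimOptimal_of_mem_securitySet (hn : 0 < n) (hm : 0 < m) {x : Fin n → ℝ}
    (hx : x ∈ securitySet A) : VictimOptimal A x (securityValue A) := by
  rw [mem_securitySet_iff hn hm] at hx
  exact ⟨⟨hx.2, hx.1.2, hx.1.1⟩, fun x' z' h => h.le_securityValue hn hm⟩

variable {A} in
theorem VictimOptimal.eq_securityValue (hn : 0 < n) (hm : 0 < m) {x : Fin n → ℝ} {z : ℝ}
    (h : VictimOptimal A x z) : z = securityValue A := by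
  obtain ⟨x', hx'⟩ := securitySet_nonempty A hn hm
  exact (h.1.le_securityValue hn hm).antisymm
    (h.2 _ _ (victimOptimal_of_mem_securitySet A hn hm hx').1)

/-- The dual description of a lower bound for the exploiter's worst case. -/
theorem forall_securitySet_le_iff (hn : 0 < n) (hm : 0 < m) (c : Fin n → ℝ) (v : ℝ) :
    (∀ x ∈ securitySet A, v ≤ x ⬝ᵥ c) ↔
      ∃ w : Fin m → ℝ, (∀ j, 0 ≤ w j) ∧ ∀ i, v ≤ c i + ∑ j, (securityValue A - A i j) * w j := by
  constructor
  · intro h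
    have hfarkas : ∀ x : Fin n → ℝ, (∀ i, 0 ≤ x i) →
        (∀ j, 0 ≤ (x ᵥ* Matrix.of fun i j => A i j - securityValue A) j) →
        0 ≤ x ⬝ᵥ fun i => c i - v := by
      intro x hx hxA
      have hc : x ⬝ᵥ (fun i => c i - v) = x ⬝ᵥ c - (∑ i, x i) * v := by
        simp only [dotProduct, mul_sub, Finset.sum_sub_distrib, Finset.sum_mul]
      have hA : ∀ j, (x ᵥ* Matrix.of fun i j => A i j - securityValue A) j =
          (x ᵥ* A) j - (∑ i, x i) * securityValue A := fun j => by
        simp only [Matrix.vecMul, dotProduct, Matrix.of_apply, mul_sub, Finset.sum_sub_distrib,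
          Finset.sum_mul]
      rw [hc]
      -- Subtracting `z` and `v` made the system homogeneous: a Farkas multiplier is either zero or,
      -- after normalisation, a point of `X*`.
      rcases (Finset.sum_nonneg fun i _ => hx i).eq_or_lt with hs | hs
      · have : x = 0 := funext fun i =>
          (Finset.sum_eq_zero_iff_of_nonneg fun i _ => hx i).1 hs.symm i (Finset.mem_univ i)
        simp [this]
      · set s := ∑ i, x i with hsdef
        have hmem : s⁻¹ • x ∈ securitySet A := by
          refine (mem_securitySet_iff hn hm).2
            ⟨⟨fun i => mul_nonneg (inv_nonneg.2 hs.le) (hx i), ?_⟩, fun j => ?_⟩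
          · simp only [Pi.smul_apply, smul_eq_mul, ← Finset.mul_sum, ← hsdef]
            exact inv_mul_cancel₀ hs.ne'
          · have := hxA j
            rw [hA] at this
            rw [Matrix.smul_vecMul, Pi.smul_apply, smul_eq_mul, le_inv_mul_iff₀ hs]
            linarith
        have := h _ hmem
        rw [smul_dotProduct, smul_eq_mul, le_inv_mul_iff₀ hs] at this
        linarith
    obtain ⟨w, hw, hle⟩ := exists_nonneg_mulVec_le _ _ hfarkas
    refine ⟨w, hw, fun i => ?_⟩
    have := hle i
    simp only [Matrix.mulVec, dotProduct, Matrix.of_apply] at this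
    have e : ∑ j, (securityValue A - A i j) * w j = -∑ j, (A i j - securityValue A) * w j := by
      rw [← Finset.sum_neg_distrib]
      exact Finset.sum_congr rfl fun j _ => by ring
    linarith
  · rintro ⟨w, hw, hle⟩ x hx
    rw [mem_securitySet_iff hn hm] at hx
    have h1 := le_dotProduct_of_mem_stdSimplex hx.1 hle
    have h2 : (x ⬝ᵥ fun i => c i + ∑ j, (securityValue A - A i j) * w j) =
        x ⬝ᵥ c - ∑ j, ((x ᵥ* A) j - securityValue A) * w j := by
      have hs : ∀ j, ((x ᵥ* A) j - securityValue A) * w j =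
          -∑ i, x i * ((securityValue A - A i j) * w j) := fun j => by
        rw [← Finset.sum_neg_distrib]
        calc _ = ((x ᵥ* A) j - (∑ i, x i) * securityValue A) * w j := by rw [hx.1.2, one_mul]
          _ = _ := by
            simp only [Matrix.vecMul, dotProduct, Finset.sum_mul, ← Finset.sum_sub_distrib]
            exact Finset.sum_congr rfl fun i _ => by ring
      simp only [hs, Finset.sum_neg_distrib, sub_neg_eq_add]
      rw [Finset.sum_comm]
      simp only [dotProduct, mul_add, Finset.sum_add_distrib, Finset.mul_sum]
    -- Weak duality: averaging over `x ∈ X*` makes the correction by `w` nonpositive.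
    have h3 : 0 ≤ ∑ j, ((x ᵥ* A) j - securityValue A) * w j :=
      Finset.sum_nonneg fun j _ => mul_nonneg (sub_nonneg.2 (hx.2 j)) (hw j)
    linarith

theorem mem_exploiterViser_iff (hn : 0 < n) (hm : 0 < m) {y : Fin m → ℝ} :
    y ∈ exploiterViser A B ↔ y ∈ stdSimplex ℝ (Fin m) ∧ ∃ w : Fin m → ℝ, (∀ j, 0 ≤ w j) ∧
      ∀ i, exploiterPayoff A B ≤ (B *ᵥ y) i + ∑ j, (securityValue A - A i j) * w j := by
  rw [exploiterViser, (maximinAttained_exploiter A B hn hm).mem_maximinSet_iff,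
    ← forall_securitySet_le_iff A hn hm]
  rfl

variable {A B} in
/-- For given `y` and `w`, the best `α` in the exploiter's LP. -/
theorem exploiterFeasible_iff {z : ℝ} {y w : Fin m → ℝ} {v : ℝ} :
    ExploiterFeasible A B y w (z * ∑ j, w j - v) ↔ y ∈ stdSimplex ℝ (Fin m) ∧
      (∀ j, 0 ≤ w j) ∧ ∀ i, v ≤ (B *ᵥ y) i + ∑ j, (z - A i j) * w j := by
  have key : ∀ i, ∑ j, (z - A i j) * w j = z * ∑ j, w j - (A *ᵥ w) i := fun i => by
    simp only [sub_mul, Finset.sum_sub_distrib, Finset.mul_sum, Matrix.mulVec, dotProduct]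
  simp only [ExploiterFeasible, key]
  constructor
  · rintro ⟨h1, h2, h3, h4⟩
    exact ⟨⟨h3, h2⟩, h4, fun i => by linarith [h1 i]⟩
  · rintro ⟨⟨h3, h2⟩, h4, h1⟩
    exact ⟨fun i => by linarith [h1 i], h2, h3, h4⟩

variable {A B} in
theorem ExploiterFeasible.le_worstCase (hn : 0 < n) (hm : 0 < m) {y w : Fin m → ℝ} {a : ℝ}
    (h : ExploiterFeasible A B y w a) : y ∈ stdSimplex ℝ (Fin m) ∧
      securityValue A * ∑ j, w j - a ≤ worstCase (securitySet A) (fun y x => x ⬝ᵥ (B *ᵥ y)) y := by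
  -- Rewrite `a` as `z 1ᵀw - v`, with `v` the objective value.
  rw [← sub_sub_cancel (securityValue A * ∑ j, w j) a, exploiterFeasible_iff] at h
  refine ⟨h.1, ((maximinAttained_exploiter A B hn hm).le_worstCase_iff h.1).2 ?_⟩
  exact (forall_securitySet_le_iff A hn hm _ _).2 ⟨w, h.2⟩

theorem exists_exploiterOptimal (hn : 0 < n) (hm : 0 < m) : ∃ y w a,
    ExploiterOptimal A B (securityValue A) y w a ∧
      securityValue A * ∑ j, w j - a = exploiterPayoff A B := by
  have hB := maximinAttained_exploiter A B hn hm
  obtain ⟨y, hy⟩ := exploiterViser_nonempty A B hn hm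
  obtain ⟨hy, w, hw, hle⟩ := (mem_exploiterViser_iff A B hn hm).1 hy
  refine ⟨y, w, _, ⟨exploiterFeasible_iff.2 ⟨hy, hw, hle⟩, fun y' w' a' h' => ?_⟩,
    sub_sub_cancel _ _⟩
  rw [sub_sub_cancel]
  obtain ⟨h1, h2⟩ := h'.le_worstCase hn hm
  exact h2.trans (hB.worstCase_le_maximinValue h1)

variable {A B} in
theorem ExploiterOptimal.value_eq (hn : 0 < n) (hm : 0 < m) {y w : Fin m → ℝ} {a : ℝ}
    (h : ExploiterOptimal A B (securityValue A) y w a) :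
    securityValue A * ∑ j, w j - a = exploiterPayoff A B ∧ y ∈ exploiterViser A B := by
  have hB := maximinAttained_exploiter A B hn hm
  obtain ⟨y', w', a', h', hv⟩ := exists_exploiterOptimal A B hn hm
  obtain ⟨h1, h2⟩ := h.1.le_worstCase hn hm
  have h3 := hv ▸ h.2 _ _ _ h'.1
  exact ⟨(h2.trans (hB.worstCase_le_maximinValue h1)).antisymm h3,
    hB.mem_maximinSet_iff_worstCase.2 ⟨h1, h3.trans h2⟩⟩

theorem isPolytope_exploiterViser (hn : 0 < n) (hm : 0 < m) :
    IsPolytope (exploiterViser A B) := by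
  have hb : Bornology.IsBounded (exploiterViser A B) :=
    (isCompact_stdSimplex ℝ (Fin m)).isBounded.subset fun _ hy => hy.1
  refine IsPolyhedron.isPolytope ?_ hb
  have h1 : IsPolyhedron {p : (Fin m → ℝ) × (Fin m → ℝ) | p.1 ∈ stdSimplex ℝ (Fin m)} :=
    (isPolyhedron_stdSimplex m).preimage (LinearMap.fst ℝ (Fin m → ℝ) (Fin m → ℝ))
  have h2 : IsPolyhedron {p : (Fin m → ℝ) × (Fin m → ℝ) | ∀ j, 0 ≤ p.2 j} :=
    .setOf_forall fun j => by
      simpa using IsPolyhedron.halfspace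
        (-(LinearMap.proj (R := ℝ) (φ := fun _ : Fin m => ℝ) j ∘ₗ LinearMap.snd ℝ (Fin m → ℝ) _)) 0
  have h3 : IsPolyhedron {p : (Fin m → ℝ) × (Fin m → ℝ) | ∀ i,
      exploiterPayoff A B ≤ (B *ᵥ p.1) i + ∑ j, (securityValue A - A i j) * p.2 j} :=
    .setOf_forall fun i => by
      convert IsPolyhedron.halfspace (-(LinearMap.proj (R := ℝ) (φ := fun _ : Fin n => ℝ) i ∘ₗ
        (B.mulVecLin ∘ₗ LinearMap.fst ℝ _ (Fin m → ℝ) +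
          (Matrix.of fun i j => securityValue A - A i j).mulVecLin ∘ₗ
            LinearMap.snd ℝ (Fin m → ℝ) _))) (-exploiterPayoff A B) using 1
      ext p
      simp [Matrix.mulVec, dotProduct, -neg_add_rev]
  -- The dual description is polyhedral in `(y, w)`; projecting away `w` keeps it so.
  have h4 := (h1.inter (h2.inter h3)).exists_pi
  have h5 : exploiterViser A B = {y | ∃ w : Fin m → ℝ, (y, w) ∈
      {p : (Fin m → ℝ) × (Fin m → ℝ) | p.1 ∈ stdSimplex ℝ (Fin m)} ∩
        ({p | ∀ j, 0 ≤ p.2 j} ∩ {p | ∀ i, exploiterPayoff A B ≤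
          (B *ᵥ p.1) i + ∑ j, (securityValue A - A i j) * p.2 j})} := by
    ext y
    rw [mem_exploiterViser_iff A B hn hm]
    simp
  rwa [h5]

end Bimatrix

/-! ## Backward induction -/

/-- The solution of the backward recursion `W_h = F_h (W_{h+1})`, `W` being `0` after the last
step. -/
def backwardSolution {S : Type*} {H : ℕ} (F : Fin H → (S → ℝ) → S → ℝ) (h : Fin H) : S → ℝ :=
  F h fun s => if hk : (h : ℕ) + 1 < H then backwardSolution F ⟨h + 1, hk⟩ s else 0
termination_by H - h
decreasing_by omega

theorem backwardSolution_eq {S : Type*} {H : ℕ} (F : Fin H → (S → ℝ) → S → ℝ) (h : Fin H) :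
    backwardSolution F h = F h (nextValue (backwardSolution F) h) := by
  rw [backwardSolution]
  rfl

theorem Fin.backward_induction {H : ℕ} {p : Fin H → Prop} (ih : ∀ h, (∀ k, h < k → p k) → p h)
    (h : Fin H) : p h := by
  induction hd : H - h using Nat.strong_induction_on generalizing h with
  | _ d hrec => exact ih h fun k hk => hrec _ (by have := k.2; omega) k rfl

theorem nextValue_mono {S : Type*} {H : ℕ} {V W : Fin H → S → ℝ} {h : Fin H}
    (hVW : ∀ k, h < k → ∀ s, V k s ≤ W k s) (s : S) : nextValue V h s ≤ nextValue W h s := by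
  unfold nextValue
  split_ifs with hk
  · exact hVW _ (Fin.lt_def.2 (Nat.lt_succ_self _)) s
  · exact le_rfl

/-- A zero-sum dynamic game in strategic form: the leader chooses `p` with `p h s ∈ Y`, the follower
`q` with `q h s ∈ X h s`, and the value `V` satisfies the Bellman equation with the one-step payoff
`g`; `W` is the solution of the max-min recursion. -/
structure BackwardGame {S : Type*} {H : ℕ} {α β : Type*} (Y : Set α) (X : Fin H → S → Set β)
    (g : Fin H → S → α → β → (S → ℝ) → ℝ) (V : (Fin H → S → α) → (Fin H → S → β) → Fin H → S → ℝ)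
    (W : Fin H → S → ℝ) : Prop where
  bellman : ∀ p q h s, V p q h s = g h s (p h s) (q h s) (nextValue (V p q) h)
  mono : ∀ h s, ∀ y ∈ Y, ∀ x ∈ X h s, Monotone (g h s y x)
  attained : ∀ h s, MaximinAttained Y (X h s) (fun y x => g h s y x (nextValue W h))
  value_eq : ∀ h s, W h s = maximinValue Y (X h s) (fun y x => g h s y x (nextValue W h))

namespace BackwardGame

variable {S : Type*} {H : ℕ} {α β : Type*} {Y : Set α} {X : Fin H → S → Set β}
  {g : Fin H → S → α → β → (S → ℝ) → ℝ} {V : (Fin H → S → α) → (Fin H → S → β) → Fin H → S → ℝ}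
  {W : Fin H → S → ℝ}

/-- The follower's best response in all stage games. -/
theorem exists_response (G : BackwardGame Y X g V W) {p : Fin H → S → α} (hp : ∀ h s, p h s ∈ Y) :
    ∃ q : Fin H → S → β, (∀ h s, q h s ∈ X h s) ∧
      ∀ h s, V p q h s ≤ worstCase (X h s) (fun y x => g h s y x (nextValue W h)) (p h s) := by
  -- `q` minimises against the continuation `W`, not against the actual future value. Monotonicity
  -- suffices, as the latter is at most `W` by induction.
  choose q hq hqe using fun h s => (G.attained h s).exists_eq_worstCase (hp h s)
  refine ⟨q, hq, fun h => ?_⟩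
  induction h using Fin.backward_induction with
  | ih h ih =>
    intro s
    rw [G.bellman, ← hqe h s]
    refine G.mono h s _ (hp h s) _ (hq h s) (nextValue_mono fun k hk s' => (ih k hk s').trans ?_)
    rw [G.value_eq k s']
    exact (G.attained k s').worstCase_le_maximinValue (hp k s')

theorem exists_response_le (G : BackwardGame Y X g V W) {p : Fin H → S → α}
    (hp : ∀ h s, p h s ∈ Y) :
    ∃ q : Fin H → S → β, (∀ h s, q h s ∈ X h s) ∧ ∀ h s, V p q h s ≤ W h s := by
  obtain ⟨q, hq, hle⟩ := G.exists_response hp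
  refine ⟨q, hq, fun h s => (hle h s).trans ?_⟩
  rw [G.value_eq h s]
  exact (G.attained h s).worstCase_le_maximinValue (hp h s)

/-- Backward induction with monotone payoffs. Only decisions at `(h, s)` and at later steps matter,
which is what `victimFuture` restricts. -/
theorem le_value (G : BackwardGame Y X g V W) {p : Fin H → S → α} {q : Fin H → S → β} (h : Fin H) :
    ∀ s, p h s ∈ maximinSet Y (X h s) (fun y x => g h s y x (nextValue W h)) →
      (∀ k, h < k → ∀ s', p k s' ∈
        maximinSet Y (X k s') (fun y x => g k s' y x (nextValue W k))) →
      q h s ∈ X h s → (∀ k, h < k → ∀ s', q k s' ∈ X k s') → W h s ≤ V p q h s := by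
  induction h using Fin.backward_induction with
  | ih h ih =>
    intro s hp hp' hq hq'
    rw [G.bellman]
    refine ((G.value_eq h s).trans_le
      (((G.attained h s).mem_maximinSet_iff.1 hp).2 _ hq)).trans ?_
    exact G.mono h s _ hp.1 _ hq (nextValue_mono fun k hk s' =>
      ih k hk s' (hp' k hk s') (fun l hl => hp' l (hk.trans hl)) (hq' k hk s')
        fun l hl => hq' l (hk.trans hl))

variable {F : Set (Fin H → S → β)} {h : Fin H} {s : S}

/-- `F` is only sandwiched, since `victimFuture` leaves earlier steps and the other states of step
`h` free within the simplex. -/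
theorem maximinValue_eq (G : BackwardGame Y X g V W)
    (hF : ∀ q ∈ F, q h s ∈ X h s ∧ ∀ k, h < k → ∀ s', q k s' ∈ X k s')
    (hF' : ∀ q : Fin H → S → β, (∀ h s, q h s ∈ X h s) → q ∈ F)
    (hatt : MaximinAttained {p : Fin H → S → α | ∀ h s, p h s ∈ Y} F (fun p q => V p q h s)) :
    maximinValue {p : Fin H → S → α | ∀ h s, p h s ∈ Y} F (fun p q => V p q h s) = W h s := by
  refine hatt.maximinValue_eq (fun p hp => ?_) ?_
  · obtain ⟨q, hq, hle⟩ := G.exists_response_le hp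
    exact ⟨q, hF' q hq, hle h s⟩
  · choose p hp using fun h s => (G.attained h s).nonempty
    exact ⟨p, fun h s => (hp h s).1, fun q hq =>
      G.le_value h s (hp h s) (fun k _ => hp k) (hF q hq).1 (hF q hq).2⟩

/-- The stagewise response holds the value of `p` down to the matrix-game worst case of `p h s`, so
that worst case must reach `W h s`. -/
theorem apply_mem_of_mem_maximinSet (G : BackwardGame Y X g V W)
    (hF : ∀ q ∈ F, q h s ∈ X h s ∧ ∀ k, h < k → ∀ s', q k s' ∈ X k s')
    (hF' : ∀ q : Fin H → S → β, (∀ h s, q h s ∈ X h s) → q ∈ F)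
    (hatt : MaximinAttained {p : Fin H → S → α | ∀ h s, p h s ∈ Y} F (fun p q => V p q h s))
    {p : Fin H → S → α}
    (hp : p ∈ maximinSet {p : Fin H → S → α | ∀ h s, p h s ∈ Y} F (fun p q => V p q h s)) :
    p h s ∈ maximinSet Y (X h s) (fun y x => g h s y x (nextValue W h)) := by
  rw [(G.attained h s).mem_maximinSet_iff_worstCase, ← G.value_eq]
  refine ⟨hp.1 h s, ?_⟩
  obtain ⟨q, hq, hle⟩ := G.exists_response hp.1
  rw [← G.maximinValue_eq hF hF' hatt]
  exact ((hatt.mem_maximinSet_iff.1 hp).2 q (hF' q hq)).trans (hle h s)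

theorem mem_maximinSet (G : BackwardGame Y X g V W)
    (hF : ∀ q ∈ F, q h s ∈ X h s ∧ ∀ k, h < k → ∀ s', q k s' ∈ X k s')
    (hF' : ∀ q : Fin H → S → β, (∀ h s, q h s ∈ X h s) → q ∈ F)
    (hatt : MaximinAttained {p : Fin H → S → α | ∀ h s, p h s ∈ Y} F (fun p q => V p q h s))
    {p : Fin H → S → α} (hpY : ∀ h s, p h s ∈ Y)
    (hp : p h s ∈ maximinSet Y (X h s) (fun y x => g h s y x (nextValue W h)))
    (hp' : ∀ k, h < k → ∀ s', p k s' ∈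
      maximinSet Y (X k s') (fun y x => g k s' y x (nextValue W k))) :
    p ∈ maximinSet {p : Fin H → S → α | ∀ h s, p h s ∈ Y} F (fun p q => V p q h s) := by
  rw [hatt.mem_maximinSet_iff, G.maximinValue_eq hF hF' hatt]
  exact ⟨hpY, fun q hq => G.le_value h s hp hp' (hF q hq).1 (hF q hq).2⟩

end BackwardGame

/-! ## The value of a Markov game -/

section Policies

variable {S : Type*} {H k : ℕ}

theorem isCompact_setOf_forall_mem {X : Fin H → S → Set (Fin k → ℝ)}
    (hX : ∀ h s, IsCompact (X h s)) : IsCompact {q : Fin H → S → Fin k → ℝ | ∀ h s, q h s ∈ X h s} := by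
  have := isCompact_univ_pi fun h => isCompact_univ_pi (hX h)
  convert this using 1
  ext q
  simp [Set.mem_pi]

theorem isCompact_policies : IsCompact (policies S H k) :=
  isCompact_setOf_forall_mem fun _ _ => isCompact_stdSimplex ℝ _

theorem policies_nonempty (hk : 0 < k) : (policies S H k).Nonempty := by
  obtain ⟨x, hx⟩ := stdSimplex_nonempty hk
  exact ⟨fun _ _ => x, fun _ _ => hx⟩

end Policies

namespace MarkovGame

variable {S : Type*} [Fintype S] {n m H : ℕ} (G : MarkovGame S n m H)

section Value

variable (π : Fin H → S → Fin n → ℝ) (ν : Fin H → S → Fin m → ℝ)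

theorem stateLaw_eq_sum (h : Fin H) (d : S → ℝ) (j : ℕ) (x : S) :
    G.stateLaw π ν h d j x = ∑ s, d s * G.stateLaw π ν h (pointMass s) j x := by
  classical
  induction j generalizing x with
  | zero => simp [stateLaw, pointMass, Set.indicator_apply]
  | succ j ih =>
    simp only [stateLaw]
    split_ifs with hk
    · simp only [ih, Finset.sum_mul, Finset.mul_sum]
      rw [Finset.sum_comm]
      simp only [mul_assoc]
    · simp

theorem expectedReward_eq_sum (u : Player) (h : Fin H) (d : S → ℝ) :
    G.expectedReward u h d π ν = ∑ s, d s * G.value u h s π ν := by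
  simp only [value, expectedReward, Finset.mul_sum]
  symm
  rw [Finset.sum_comm]
  refine Finset.sum_congr rfl fun k _ => ?_
  rw [Finset.sum_comm]
  refine Finset.sum_congr rfl fun x _ => ?_
  rw [G.stateLaw_eq_sum π ν h d, Finset.sum_mul]
  simp only [mul_assoc]

/-- The recursion for `stateLaw` appends the last transition; the Bellman equation needs the first
one split off. -/
theorem stateLaw_succ (h : Fin H) (hk : (h : ℕ) + 1 < H) (d : S → ℝ) (j : ℕ) :
    G.stateLaw π ν h d (j + 1) = G.stateLaw π ν ⟨h + 1, hk⟩
      (fun x' => ∑ x, d x * G.transition π ν h x x') j := by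
  induction j with
  | zero =>
    ext x'
    simp [stateLaw]
  | succ j ih =>
    ext x'
    have : (h : ℕ) + (j + 1) = h + 1 + j := by omega
    rw [stateLaw, stateLaw.eq_2 G π ν ⟨h + 1, hk⟩]
    simp only [ih, this]

theorem expectedReward_eq_add (u : Player) (h : Fin H) (d : S → ℝ) :
    G.expectedReward u h d π ν = ∑ x, d x * (π h x ⬝ᵥ (G.R u h x *ᵥ ν h x)) +
      if hk : (h : ℕ) + 1 < H then G.expectedReward u ⟨h + 1, hk⟩
        (fun x' => ∑ x, d x * G.transition π ν h x x') π ν else 0 := by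
  rw [expectedReward, ← Finset.Ioi_insert, Finset.sum_insert (by simp)]
  congr 1
  · simp [stateLaw]
  · split_ifs with hk
    · have hI : Finset.Ioi h = Finset.Ici (⟨h + 1, hk⟩ : Fin H) := by
        ext k
        rw [Finset.mem_Ioi, Finset.mem_Ici, Fin.lt_def, Fin.le_def, Nat.succ_le_iff]
      rw [hI, expectedReward]
      refine Finset.sum_congr rfl fun k hkm => Finset.sum_congr rfl fun x _ => ?_
      have hle : (h : ℕ) + 1 ≤ k := Fin.le_def.1 (Finset.mem_Ici.1 hkm)
      rw [← stateLaw_succ]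
      congr 2
      simp only
      omega
    · refine Finset.sum_eq_zero fun k hkm => ?_
      have := Fin.lt_def.1 (Finset.mem_Ioi.1 hkm)
      have := k.2
      omega

/-- The Bellman equation. -/
theorem value_eq (u : Player) (h : Fin H) (s : S) : G.value u h s π ν =
    π h s ⬝ᵥ (G.stageMatrix u (fun k s' => G.value u k s' π ν) h s *ᵥ ν h s) := by
  classical
  have hR : G.value u h s π ν = π h s ⬝ᵥ (G.R u h s *ᵥ ν h s) + ∑ s', G.transition π ν h s s' *
      nextValue (fun k s' => G.value u k s' π ν) h s' := by
    rw [value, expectedReward_eq_add]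
    congr 1
    · simp [pointMass, Set.indicator_apply]
    · by_cases hk : (h : ℕ) + 1 < H
      · simp [hk, nextValue, expectedReward_eq_sum, pointMass, Set.indicator_apply]
      · simp [hk, nextValue]
  have hP : ∑ s', G.transition π ν h s s' * nextValue (fun k s' => G.value u k s' π ν) h s' =
      ∑ a, π h s a * ∑ b, (∑ s', G.P h s a b s' *
        nextValue (fun k s' => G.value u k s' π ν) h s') * ν h s b := by
    simp only [transition, Finset.sum_mul, Finset.mul_sum]
    rw [Finset.sum_comm]
    refine Finset.sum_congr rfl fun a _ => ?_
    rw [Finset.sum_comm]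
    refine Finset.sum_congr rfl fun b _ => Finset.sum_congr rfl fun s' _ => by ring
  rw [hR, hP]
  simp only [dotProduct, Matrix.mulVec, stageMatrix, Matrix.of_apply, add_mul,
    Finset.sum_add_distrib, mul_add]

theorem continuous_stateLaw (h : Fin H) (d : S → ℝ) (j : ℕ) (x : S) :
    Continuous fun p : (Fin H → S → Fin n → ℝ) × (Fin H → S → Fin m → ℝ) =>
      G.stateLaw p.1 p.2 h d j x := by
  induction j generalizing x with
  | zero => exact continuous_const
  | succ j ih =>
    simp only [stateLaw]
    split_ifs with hk
    · unfold transition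
      fun_prop
    · exact continuous_const

theorem continuous_expectedReward (u : Player) (h : Fin H) (d : S → ℝ) :
    Continuous fun p : (Fin H → S → Fin n → ℝ) × (Fin H → S → Fin m → ℝ) =>
      G.expectedReward u h d p.1 p.2 := by
  have := G.continuous_stateLaw h d
  unfold expectedReward
  fun_prop

end Value

theorem monotone_stageMatrix (u : Player) (h : Fin H) (s : S) {x : Fin n → ℝ} {y : Fin m → ℝ}
    (hx : x ∈ stdSimplex ℝ (Fin n)) (hy : y ∈ stdSimplex ℝ (Fin m)) :
    Monotone fun f : S → ℝ => x ⬝ᵥ ((Matrix.of fun a b => G.R u h s a b +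
      ∑ s', G.P h s a b s' * f s') *ᵥ y) := by
  intro f f' hf
  simp only [dotProduct, Matrix.mulVec, Matrix.of_apply]
  refine Finset.sum_le_sum fun a _ => mul_le_mul_of_nonneg_left
    (Finset.sum_le_sum fun b _ => mul_le_mul_of_nonneg_right ?_ (hy.1 b)) (hx.1 a)
  gcongr with s'
  · exact (G.P_mem h s a b).1 s'
  · exact hf s'

end MarkovGame

namespace MarkovGame

variable {S : Type*} [Fintype S] {n m H : ℕ} (G : MarkovGame S n m H)

/-- The stage matrix for the continuation value `f` at the next step. -/
def continuationMatrix (u : Player) (h : Fin H) (s : S) (f : S → ℝ) : Matrix (Fin n) (Fin m) ℝ :=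
  Matrix.of fun a b => G.R u h s a b + ∑ s', G.P h s a b s' * f s'

/-! ### The victim's stage sets and security strategies -/

section Victim

theorem maximinAttained_victim (hn : 0 < n) (hm : 0 < m) (h : Fin H) (s : S) :
    MaximinAttained (policies S H n) (policies S H m) (fun π ν => G.value .victim h s π ν) :=
  maximinAttained_of_isCompact isCompact_policies isCompact_policies (policies_nonempty hn)
    (policies_nonempty hm) (G.continuous_expectedReward _ _ _)

/-- Stated for any solution `W` of the recursion, because `optValue` is known to be one only after
being identified with `W`. -/
theorem victim_backwardGame_of_eq (hn : 0 < n) (hm : 0 < m) {W : Fin H → S → ℝ}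
    (hW : ∀ h s, W h s = securityValue (G.stageMatrix .victim W h s)) :
    BackwardGame (stdSimplex ℝ (Fin n)) (fun (_ : Fin H) (_ : S) => stdSimplex ℝ (Fin m))
      (fun h s x y f => x ⬝ᵥ (G.continuationMatrix .victim h s f *ᵥ y))
      (fun π ν h s => G.value .victim h s π ν) W where
  bellman π ν h s := G.value_eq π ν .victim h s
  mono h s _ hx _ hy := G.monotone_stageMatrix .victim h s hx hy
  attained h s := maximinAttained_security (G.stageMatrix .victim W h s) hn hm
  value_eq := hW

theorem optValue_victim (hn : 0 < n) (hm : 0 < m) (h : Fin H) (s : S) :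
    G.optValue .victim h s = securityValue (G.optQ .victim h s) := by
  set W : Fin H → S → ℝ :=
    backwardSolution fun h f s => securityValue (G.continuationMatrix .victim h s f)
  have hW : ∀ h s, W h s = securityValue (G.stageMatrix .victim W h s) := fun h s =>
    congrFun (backwardSolution_eq _ h) s
  have : G.optValue .victim = W := by
    ext h s
    exact (G.victim_backwardGame_of_eq hn hm hW).maximinValue_eq
      (fun q hq => ⟨hq h s, fun k _ s' => hq k s'⟩) (fun q hq => hq)
      (G.maximinAttained_victim hn hm h s)
  rw [optQ, this]
  exact hW h s

theorem victim_backwardGame (hn : 0 < n) (hm : 0 < m) :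
    BackwardGame (stdSimplex ℝ (Fin n)) (fun (_ : Fin H) (_ : S) => stdSimplex ℝ (Fin m))
      (fun h s x y f => x ⬝ᵥ (G.continuationMatrix .victim h s f *ᵥ y))
      (fun π ν h s => G.value .victim h s π ν) (G.optValue .victim) :=
  G.victim_backwardGame_of_eq hn hm (G.optValue_victim hn hm)

theorem apply_mem_securitySet (hn : 0 < n) (hm : 0 < m) {h : Fin H} {s : S}
    {π : Fin H → S → Fin n → ℝ} (hπ : π ∈ G.victimStage h s) :
    π h s ∈ securitySet (G.optQ .victim h s) :=
  (G.victim_backwardGame hn hm).apply_mem_of_mem_maximinSet (F := policies S H m)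
    (fun _ hq => ⟨hq h s, fun k _ s' => hq k s'⟩) (fun _ hq => hq)
    (G.maximinAttained_victim hn hm h s) hπ

theorem mem_victimStage (hn : 0 < n) (hm : 0 < m) {h : Fin H} {s : S}
    {π : Fin H → S → Fin n → ℝ} (hπ : π ∈ policies S H n)
    (hs : π h s ∈ securitySet (G.optQ .victim h s))
    (hk : ∀ k, h < k → ∀ s', π k s' ∈ securitySet (G.optQ .victim k s')) :
    π ∈ G.victimStage h s :=
  (G.victim_backwardGame hn hm).mem_maximinSet (F := policies S H m)
    (fun _ hq => ⟨hq h s, fun k _ s' => hq k s'⟩) (fun _ hq => hq)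
    (G.maximinAttained_victim hn hm h s) hπ hs hk

/-- Each stage set fixes the decision at its own stage, and these local conditions now and later
suffice for all the stage sets involved. -/
theorem mem_victimFuture_iff (hn : 0 < n) (hm : 0 < m) {h : Fin H} {s : S}
    {π : Fin H → S → Fin n → ℝ} : π ∈ G.victimFuture h s ↔ π ∈ policies S H n ∧
      π h s ∈ securitySet (G.optQ .victim h s) ∧
      ∀ k, h < k → ∀ s', π k s' ∈ securitySet (G.optQ .victim k s') := by
  constructor
  · rintro ⟨h1, h2⟩
    exact ⟨h1.1, G.apply_mem_securitySet hn hm h1,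
      fun k hk s' => G.apply_mem_securitySet hn hm (h2 k hk s')⟩
  · rintro ⟨hπ, h1, h2⟩
    exact ⟨G.mem_victimStage hn hm hπ h1 h2, fun k hk s' =>
      G.mem_victimStage hn hm hπ (h2 k hk s') fun l hl => h2 l (hk.trans hl)⟩

theorem victimMPViser_eq (hn : 0 < n) (hm : 0 < m) :
    G.victimMPViser = {π | ∀ h s, π h s ∈ securitySet (G.optQ .victim h s)} := by
  ext π
  simp only [victimMPViser, Set.mem_iInter, Set.mem_ofPred_eq]
  exact ⟨fun hπ h s => G.apply_mem_securitySet hn hm (hπ h s), fun hπ h s =>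
    G.mem_victimStage hn hm (fun k s' => (hπ k s').1) (hπ h s) fun k _ => hπ k⟩

theorem isCompact_victimMPViser (hn : 0 < n) (hm : 0 < m) : IsCompact G.victimMPViser := by
  rw [G.victimMPViser_eq hn hm]
  exact isCompact_setOf_forall_mem fun h s => isCompact_securitySet _ hn hm

theorem victimMPViser_nonempty (hn : 0 < n) (hm : 0 < m) : G.victimMPViser.Nonempty := by
  rw [G.victimMPViser_eq hn hm]
  choose π hπ using fun h s => securitySet_nonempty (G.optQ .victim h s) hn hm
  exact ⟨π, hπ⟩

theorem victimMPViser_subset_victimFuture (h : Fin H) (s : S) :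
    G.victimMPViser ⊆ G.victimFuture h s := by
  intro π hπ
  simp only [victimMPViser, Set.mem_iInter] at hπ
  exact ⟨hπ h s, fun k _ => hπ k⟩

theorem isCompact_victimFuture (hn : 0 < n) (hm : 0 < m) (h : Fin H) (s : S) :
    IsCompact (G.victimFuture h s) := by
  have : G.victimFuture h s = policies S H n ∩ ({π | π h s ∈ securitySet (G.optQ .victim h s)} ∩
      ⋂ k, ⋂ _ : h < k, ⋂ s', {π | π k s' ∈ securitySet (G.optQ .victim k s')}) := by
    ext π
    simp [G.mem_victimFuture_iff hn hm]
  have hc : ∀ k s', IsClosed {π : Fin H → S → Fin n → ℝ |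
      π k s' ∈ securitySet (G.optQ .victim k s')} := fun k s' =>
    (isCompact_securitySet _ hn hm).isClosed.preimage (by fun_prop)
  rw [this]
  exact isCompact_policies.inter_right ((hc h s).inter
    (isClosed_iInter fun k => isClosed_iInter fun _ => isClosed_iInter fun s' => hc k s'))

end Victim

/-! ### The exploiter against stagewise security strategies -/

section Exploiter

theorem maximinAttained_exploiterStage (hn : 0 < n) (hm : 0 < m) (h : Fin H) (s : S) :
    MaximinAttained (policies S H m) (G.victimFuture h s)
      (fun ν π => G.value .exploiter h s π ν) :=
  maximinAttained_of_isCompact isCompact_policies (G.isCompact_victimFuture hn hm h s)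
    (policies_nonempty hm)
    ((G.victimMPViser_nonempty hn hm).mono (G.victimMPViser_subset_victimFuture h s))
    ((G.continuous_expectedReward _ _ _).comp continuous_swap)

theorem maximinAttained_exploiterTotal (hn : 0 < n) (hm : 0 < m) (hH : 0 < H) :
    MaximinAttained (policies S H m) G.victimMPViser (G.exploiterTotal hH) :=
  maximinAttained_of_isCompact isCompact_policies (G.isCompact_victimMPViser hn hm)
    (policies_nonempty hm) (G.victimMPViser_nonempty hn hm)
    ((G.continuous_expectedReward _ _ _).comp continuous_swap)

theorem exploiter_backwardGame_of_eq (hn : 0 < n) (hm : 0 < m) {W : Fin H → S → ℝ}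
    (hW : ∀ h s, W h s = exploiterPayoff (G.optQ .victim h s) (G.stageMatrix .exploiter W h s)) :
    BackwardGame (stdSimplex ℝ (Fin m)) (fun (h : Fin H) (s : S) => securitySet (G.optQ .victim h s))
      (fun h s y x f => x ⬝ᵥ (G.continuationMatrix .exploiter h s f *ᵥ y))
      (fun ν π h s => G.value .exploiter h s π ν) W where
  bellman ν π h s := G.value_eq π ν .exploiter h s
  mono h s _ hy _ hx := G.monotone_stageMatrix .exploiter h s hx.1 hy
  attained h s := maximinAttained_exploiter (G.optQ .victim h s) (G.stageMatrix .exploiter W h s)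
    hn hm
  value_eq := hW

variable {G} in
theorem mem_victimFuture_of_forall_mem (hn : 0 < n) (hm : 0 < m) {h : Fin H} {s : S}
    (π : Fin H → S → Fin n → ℝ) (hπ : ∀ h s, π h s ∈ securitySet (G.optQ .victim h s)) :
    π ∈ G.victimFuture h s :=
  G.victimMPViser_subset_victimFuture h s (by rwa [G.victimMPViser_eq hn hm])

theorem optValue_exploiter (hn : 0 < n) (hm : 0 < m) (h : Fin H) (s : S) :
    G.optValue .exploiter h s =
      exploiterPayoff (G.optQ .victim h s) (G.optQ .exploiter h s) := by
  set W : Fin H → S → ℝ := backwardSolution fun h f s =>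
    exploiterPayoff (G.optQ .victim h s) (G.continuationMatrix .exploiter h s f)
  have hW : ∀ h s, W h s = exploiterPayoff (G.optQ .victim h s) (G.stageMatrix .exploiter W h s) :=
    fun h s => congrFun (backwardSolution_eq _ h) s
  have : G.optValue .exploiter = W := by
    ext h s
    exact (G.exploiter_backwardGame_of_eq hn hm hW).maximinValue_eq
      (fun _ hq => ((G.mem_victimFuture_iff hn hm).1 hq).2)
      (mem_victimFuture_of_forall_mem hn hm) (G.maximinAttained_exploiterStage hn hm h s)
  rw [optQ, this, optQ, this]
  exact hW h s

theorem exploiter_backwardGame (hn : 0 < n) (hm : 0 < m) :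
    BackwardGame (stdSimplex ℝ (Fin m)) (fun (h : Fin H) (s : S) => securitySet (G.optQ .victim h s))
      (fun h s y x f => x ⬝ᵥ (G.continuationMatrix .exploiter h s f *ᵥ y))
      (fun ν π h s => G.value .exploiter h s π ν) (G.optValue .exploiter) :=
  G.exploiter_backwardGame_of_eq hn hm (G.optValue_exploiter hn hm)

theorem apply_mem_exploiterViser (hn : 0 < n) (hm : 0 < m) {h : Fin H} {s : S}
    {ν : Fin H → S → Fin m → ℝ} (hν : ν ∈ G.exploiterStage h s) :
    ν h s ∈ exploiterViser (G.optQ .victim h s) (G.optQ .exploiter h s) :=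
  (G.exploiter_backwardGame hn hm).apply_mem_of_mem_maximinSet
    (fun _ hq => ((G.mem_victimFuture_iff hn hm).1 hq).2)
    (mem_victimFuture_of_forall_mem hn hm) (G.maximinAttained_exploiterStage hn hm h s) hν

theorem mem_exploiterStage (hn : 0 < n) (hm : 0 < m) (h : Fin H) (s : S)
    {ν : Fin H → S → Fin m → ℝ}
    (hν : ∀ h s, ν h s ∈ exploiterViser (G.optQ .victim h s) (G.optQ .exploiter h s)) :
    ν ∈ G.exploiterStage h s :=
  (G.exploiter_backwardGame hn hm).mem_maximinSet
    (fun _ hq => ((G.mem_victimFuture_iff hn hm).1 hq).2)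
    (mem_victimFuture_of_forall_mem hn hm) (G.maximinAttained_exploiterStage hn hm h s)
    (fun h s => (hν h s).1) (hν h s) fun k _ => hν k

theorem exploiterMPViser_eq (hn : 0 < n) (hm : 0 < m) : G.exploiterMPViser =
    {ν | ∀ h s, ν h s ∈ exploiterViser (G.optQ .victim h s) (G.optQ .exploiter h s)} := by
  ext ν
  simp only [exploiterMPViser, Set.mem_iInter, Set.mem_ofPred_eq]
  exact ⟨fun hν h s => G.apply_mem_exploiterViser hn hm (hν h s),
    fun hν h s => G.mem_exploiterStage hn hm h s hν⟩

theorem exploiterMPViser_nonempty (hn : 0 < n) (hm : 0 < m) : G.exploiterMPViser.Nonempty := by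
  rw [G.exploiterMPViser_eq hn hm]
  choose ν hν using fun h s =>
    exploiterViser_nonempty (G.optQ .victim h s) (G.optQ .exploiter h s) hn hm
  exact ⟨ν, hν⟩

theorem image_exploiterStage (hn : 0 < n) (hm : 0 < m) (h : Fin H) (s : S) :
    (fun ν : Fin H → S → Fin m → ℝ => ν h s) '' G.exploiterStage h s =
      exploiterViser (G.optQ .victim h s) (G.optQ .exploiter h s) := by
  classical
  ext y
  constructor
  · rintro ⟨ν, hν, rfl⟩
    exact G.apply_mem_exploiterViser hn hm hν
  · intro hy
    obtain ⟨ν, hν⟩ := G.exploiterMPViser_nonempty hn hm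
    rw [G.exploiterMPViser_eq hn hm] at hν
    -- The stage conditions are independent, so `y` can be spliced into an MPVISER policy.
    refine ⟨Function.update ν h (Function.update (ν h) s y), ?_, by simp⟩
    refine G.mem_exploiterStage hn hm h s fun k s' => ?_
    rcases eq_or_ne k h with rfl | hk
    · rcases eq_or_ne s' s with rfl | hs
      · simpa using hy
      · simpa [hs] using hν k s'
    · simpa [hk] using hν k s'

theorem exploiterHat_eq (hn : 0 < n) (hm : 0 < m) (h : Fin H) (s : S) :
    G.exploiterHat h s = exploiterViser (G.optQ .victim h s) (G.optQ .exploiter h s) := by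
  ext y
  rw [mem_exploiterViser_iff _ _ hn hm, exploiterHat, G.optValue_victim hn hm,
    G.optValue_exploiter hn hm]
  simp only [Set.mem_iUnion, Set.mem_ofPred_eq, exists_prop]
  tauto

theorem isPolytope_exploiterMPViser (hn : 0 < n) (hm : 0 < m) : IsPolytope G.exploiterMPViser := by
  rw [G.exploiterMPViser_eq hn hm]
  refine IsPolyhedron.isPolytope (.setOf_forall fun h => .setOf_forall fun s => ?_)
    ((isCompact_policies (S := S) (H := H) (k := m)).isBounded.subset fun ν hν h s => (hν h s).1)
  exact (isPolytope_exploiterViser _ _ hn hm).isPolyhedron.preimage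
    (LinearMap.proj (R := ℝ) (φ := fun _ : S => Fin m → ℝ) s ∘ₗ
      LinearMap.proj (R := ℝ) (φ := fun _ : Fin H => S → Fin m → ℝ) h)

theorem le_exploiterTotal (hn : 0 < n) (hm : 0 < m) (hH : 0 < H) {ν : Fin H → S → Fin m → ℝ}
    (hν : ν ∈ G.exploiterMPViser) {π : Fin H → S → Fin n → ℝ} (hπ : π ∈ G.victimMPViser) :
    ∑ s, G.μ s * G.optValue .exploiter ⟨0, hH⟩ s ≤ G.exploiterTotal hH ν π := by
  rw [G.exploiterMPViser_eq hn hm] at hν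
  rw [G.victimMPViser_eq hn hm] at hπ
  rw [exploiterTotal, expectedReward_eq_sum]
  refine Finset.sum_le_sum fun s _ => mul_le_mul_of_nonneg_left ?_ (G.μ_mem.1 s)
  exact (G.exploiter_backwardGame hn hm).le_value _ s (hν _ s) (fun k _ => hν k) (hπ _ s)
    fun k _ => hπ k

theorem guaranteedPayoff_eq (hn : 0 < n) (hm : 0 < m) (hH : 0 < H) :
    G.guaranteedPayoff hH = ∑ s, G.μ s * G.optValue .exploiter ⟨0, hH⟩ s := by
  refine (G.maximinAttained_exploiterTotal hn hm hH).maximinValue_eq (fun ν hν => ?_) ?_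
  -- One `π` bounds the values from all initial states at once, so the bound survives averaging over
  -- `μ`.
  · obtain ⟨π, hπ, hle⟩ := (G.exploiter_backwardGame hn hm).exists_response_le hν
    refine ⟨π, by rwa [G.victimMPViser_eq hn hm], ?_⟩
    rw [exploiterTotal, expectedReward_eq_sum]
    exact Finset.sum_le_sum fun s _ => mul_le_mul_of_nonneg_left (hle _ s) (G.μ_mem.1 s)
  · obtain ⟨ν, hν⟩ := G.exploiterMPViser_nonempty hn hm
    refine ⟨ν, fun h s => ?_, fun π hπ => G.le_exploiterTotal hn hm hH hν hπ⟩
    rw [G.exploiterMPViser_eq hn hm] at hν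
    exact (hν h s).1

theorem worstCase_exploiterTotal (hn : 0 < n) (hm : 0 < m) (hH : 0 < H)
    {ν : Fin H → S → Fin m → ℝ} (hν : ν ∈ G.exploiterMPViser) :
    worstCase G.victimMPViser (G.exploiterTotal hH) ν = G.guaranteedPayoff hH := by
  have hatt := G.maximinAttained_exploiterTotal hn hm hH
  refine hatt.worstCase_eq (hatt.mem_maximinSet_iff.2 ⟨fun h s => ?_, fun π hπ => ?_⟩)
  · rw [G.exploiterMPViser_eq hn hm] at hν
    exact (hν h s).1
  · exact (G.guaranteedPayoff_eq hn hm hH).trans_le (G.le_exploiterTotal hn hm hH hν hπ)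

end Exploiter

/-! ### Runs of the algorithm -/

section Run

/-- The true matrices and values, with any optimal LP solutions for them, form a run. -/
theorem exists_isExploiterRun (hn : 0 < n) (hm : 0 < m) : ∃ T, G.IsExploiterRun T := by
  choose π hπ using fun h s => securitySet_nonempty (G.optQ .victim h s) hn hm
  choose ν w a hopt hval using fun h s =>
    exists_exploiterOptimal (G.optQ .victim h s) (G.optQ .exploiter h s) hn hm
  refine ⟨⟨G.optQ, G.optValue, π, ν, w, a⟩, fun _ _ _ => rfl, fun h s => ?_, fun h s => ?_,
    fun h s => ?_⟩
  · simpa only [G.optValue_victim hn hm] using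
      victimOptimal_of_mem_securitySet _ hn hm (hπ h s)
  · simpa only [G.optValue_victim hn hm] using hopt h s
  · simpa only [G.optValue_victim hn hm, G.optValue_exploiter hn hm] using (hval h s).symm

variable {G} {T : ExploiterTrace S n m H}

theorem stageMatrix_congr {u : Player} {V W : Fin H → S → ℝ} {h : Fin H}
    (hVW : ∀ k, h < k → ∀ s, V k s = W k s) (s : S) :
    G.stageMatrix u V h s = G.stageMatrix u W h s := by
  have : nextValue V h = nextValue W h := funext fun s' =>
    (nextValue_mono (fun k hk s => (hVW k hk s).le) s').antisymm
      (nextValue_mono (fun k hk s => (hVW k hk s).ge) s')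
  rw [stageMatrix, stageMatrix, this]

theorem IsExploiterRun.V_victim (hT : G.IsExploiterRun T) (hn : 0 < n) (hm : 0 < m) (h : Fin H)
    (s : S) : T.V .victim h s = securityValue (T.Q .victim h s) :=
  (hT.victim_lp h s).eq_securityValue hn hm

theorem IsExploiterRun.V_exploiter_and_mem (hT : G.IsExploiterRun T) (hn : 0 < n) (hm : 0 < m)
    (h : Fin H) (s : S) :
    T.V .exploiter h s = exploiterPayoff (T.Q .victim h s) (T.Q .exploiter h s) ∧
      T.ν h s ∈ exploiterViser (T.Q .victim h s) (T.Q .exploiter h s) := by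
  have h1 := hT.exploiter_lp h s
  rw [hT.exploiter_value, hT.V_victim hn hm]
  rw [hT.V_victim hn hm] at h1
  exact h1.value_eq hn hm

theorem IsExploiterRun.V_eq (hT : G.IsExploiterRun T) (hn : 0 < n) (hm : 0 < m) (u : Player)
    (h : Fin H) : ∀ s, T.V u h s = G.optValue u h s := by
  -- The victim's recursion is self-contained and is settled first, since the exploiter's stage
  -- problem depends on the victim's matrix.
  have hv : ∀ h s, T.V .victim h s = G.optValue .victim h s := fun h => by
    induction h using Fin.backward_induction with
    | ih h ih =>
      intro s
      rw [hT.V_victim hn hm, hT.matrices, stageMatrix_congr ih, G.optValue_victim hn hm, optQ]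
  have hQ : ∀ h s, T.Q .victim h s = G.optQ .victim h s := fun h s => by
    rw [hT.matrices, stageMatrix_congr fun k _ => hv k, optQ]
  cases u with
  | victim => exact hv h
  | exploiter =>
    induction h using Fin.backward_induction with
    | ih h ih =>
      intro s
      rw [(hT.V_exploiter_and_mem hn hm h s).1, hQ, hT.matrices, stageMatrix_congr ih,
        G.optValue_exploiter hn hm, ← optQ]

theorem IsExploiterRun.mem_exploiterMPViser (hT : G.IsExploiterRun T) (hn : 0 < n) (hm : 0 < m) :
    T.ν ∈ G.exploiterMPViser := by
  rw [G.exploiterMPViser_eq hn hm]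
  intro h s
  have hQ : ∀ u, T.Q u h s = G.optQ u h s := fun u => by
    rw [hT.matrices, stageMatrix_congr fun k _ => hT.V_eq hn hm u k, optQ]
  have := (hT.V_exploiter_and_mem hn hm h s).2
  rwa [hQ, hQ] at this

end Run

end MarkovGame

end

theorem mainTheorem5 {S : Type*} [Fintype S] {n m H : ℕ} (hn : 0 < n) (hm : 0 < m) (hH : 0 < H)
    (G : MarkovGame S n m H) :
    -- all the maxima and minima involved are attained
    (∀ h s, MaximinAttained (policies S H n) (policies S H m)
        (fun π ν => G.value .victim h s π ν) ∧
      MaximinAttained (policies S H m) (G.victimFuture h s)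
        (fun ν π => G.value .exploiter h s π ν)) ∧
    MaximinAttained (policies S H m) G.victimMPViser (G.exploiterTotal hH) ∧
    -- the algorithm has a run, and every output is an MPVISER policy with guaranteed payoff `p_e`
    (∃ T, G.IsExploiterRun T) ∧
    (∀ T, G.IsExploiterRun T →
      T.ν ∈ G.exploiterMPViser ∧
      (∀ u h s, T.V u h s = G.optValue u h s) ∧
      worstCase G.victimMPViser (G.exploiterTotal hH) T.ν = G.guaranteedPayoff hH) ∧
    ∑ s, G.μ s * G.optValue .exploiter ⟨0, hH⟩ s = G.guaranteedPayoff hH ∧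
    -- the exploiter's VISER strategies in each stage game
    (∀ h s,
      (fun ν : Fin H → S → Fin m → ℝ => ν h s) '' G.exploiterStage h s = G.exploiterHat h s ∧
      exploiterViser (G.optQ .victim h s) (G.optQ .exploiter h s) = G.exploiterHat h s ∧
      exploiterPayoff (G.optQ .victim h s) (G.optQ .exploiter h s) = G.optValue .exploiter h s ∧
      (G.exploiterHat h s).Nonempty ∧ IsPolytope (G.exploiterHat h s)) ∧
    -- the exploiter's MPVISER policies
    G.exploiterMPViser = {ν | ∀ h s, ν h s ∈ G.exploiterHat h s} ∧
    G.exploiterMPViser.Nonempty ∧ IsPolytope G.exploiterMPViser := by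
  refine ⟨fun h s => ⟨G.maximinAttained_victim hn hm h s,
    G.maximinAttained_exploiterStage hn hm h s⟩, G.maximinAttained_exploiterTotal hn hm hH,
    G.exists_isExploiterRun hn hm, fun T hT => ?_, (G.guaranteedPayoff_eq hn hm hH).symm,
    fun h s => ?_, ?_, G.exploiterMPViser_nonempty hn hm, G.isPolytope_exploiterMPViser hn hm⟩
  · have hmem := hT.mem_exploiterMPViser hn hm
    exact ⟨hmem, hT.V_eq hn hm, G.worstCase_exploiterTotal hn hm hH hmem⟩
  · rw [G.exploiterHat_eq hn hm]
    exact ⟨G.image_exploiterStage hn hm h s, rfl, (G.optValue_exploiter hn hm h s).symm,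
      exploiterViser_nonempty _ _ hn hm, isPolytope_exploiterViser _ _ hn hm⟩
  · simp only [G.exploiterMPViser_eq hn hm, G.exploiterHat_eq hn hm]
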